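/- Let $k_1,k_2,s_1\ge 1$, put $k=k_1+(k_2-1)s_1$, and identify $w\in\mathbb{C}^k$ with the form $\pi_1^{\mathbb C}(w)=\sum_{j=0}^{k-1}w[j]\,x^{k-1-j}y^j\in\mathbb{C}[x,y]_{k-1}$. For a filter $w$ of size $\kappa$ and a stride $s$, let $\alpha_{w,s}$ be the convolution $(\alpha_{w,s}u)_i=\sum_{j=0}^{\kappa-1}w[j]\,u_{is+j}$. The complex neurovariety $\mathcal{M}=\mathcal{M}^{\mathbb C}_{(k_1,k_2),(s_1,1)}\subset\mathbb{C}^k$ is the set of all $w\in\mathbb{C}^k$ such that $\alpha_{w,s_1}=\alpha_{w_2,1}\circ\alpha_{w_1,s_1}$ for some $w_1\in\mathbb{C}^{k_1}$, $w_2\in\mathbb{C}^{k_2}$. For a form $Q$ of degree $k-1$ let $q_1,\dots,q_{s_1}$ be the components of its $s_1$-decomposition, i.e. the forms $q_i\in\mathbb{C}[x,y]$ of degree $n_i=\lfloor (k-i)/s_1\rfloor$ ($q_i=0$ if $n_i<0$) with $$Q=\sum_{i=1}^{s_1}x^{i-1}y^{\,(k-i)\bmod s_1}\,q_i(x^{s_1},y^{s_1}).$$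 Let $n^*=\lfloor (k-1)/s_1\rfloor$, and let $r$ be the number of $i\in\{1,\dots,s_1\}$ with $n_i=n^*$, so that exactly $q_1,\dots,q_r$ have degree $n^*$. For the coefficients $A^{(i)}_0,\dots,A^{(i)}_{n_i}$ of $q_i=\sum_t A^{(i)}_t x^{n_i-t}y^t$, the resultant matrix $R_l$ of $q_1,\dots,q_c$ is the matrix with $l+1$ columns that has, for each $i\le c$, $\max(0,l-n_i+1)$ rows, namely $(A^{(i)}_0,\dots,A^{(i)}_{n_i},0,\dots,0)$ and its successive shifts to the right by one place. Taking $Q$ to be the form with indeterminate coefficients $w[0],\dots,w[k-1]$, let the following be ideals of $\mathbb{C}[w[0],\dots,w[k-1]]$: * $\mathfrak{I}_1$, generated by all minors of size $2n^*-2k_2+3$ of the resultant matrix $R_{2n^*-k_2}$ of $q_1,\dots,q_{s_1}$; * $\mathfrak{I}_2$, generated by all minors of size $2n^*-2k_2+4$ of the resultant matrix $R_{2n^*-k_2+1}$ of $q_1,\dots,q_r$. Then $\pi_1^{\mathbb C}(\mathcal{M})$ is the zero locus of $\mathfrak{I}=\mathfrak{I}_1+\mathfrak{I}_2$. Moreover: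 * if $r=1$, then $\mathfrak{I}_2=0$ and $\mathfrak{I}=\mathfrak{I}_1$; * if $r=\min(k_1,s_1)$, then $\mathfrak{I}_2$ alone suffices: $\pi_1^{\mathbb C}(\mathcal{M})$ consists of those forms $Q$ in the zero locus of $\mathfrak{I}_2$ for which $q_i=0$ for all $i$ with $k_1<i\le s_1$ (no condition when $k_1\ge s_1$). -/

import Mathlib

noncomputable section

/-- The convolution with filter `w` of size `k` and stride `s`,
`(α_{w,s} x)_i = ∑_{j<k} w[j] x[i s + j]`. Input and output dimensions play no role, so it acts on
infinite sequences; then the operator `α_{w,s}` determines the filter `w`. -/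
def convolution (s : ℕ) {k : ℕ} (w : Fin k → ℂ) (x : ℕ → ℂ) : ℕ → ℂ :=
  fun i => ∑ j : Fin k, w j * x (i * s + (j : ℕ))

/-- The size `k = k₁ + (k₂ - 1) s₁` of the output filter of the architecture
`((k₁, k₂), (s₁, 1))`. -/
def outputSize (k₁ k₂ s₁ : ℕ) : ℕ := k₁ + (k₂ - 1) * s₁

/-- The complex neurovariety of the architecture `((k₁, k₂), (s₁, 1))`: all complex filters `w` of
size `k` such that the convolution with filter `w` and stride `s₁ · 1` is a composition
`α_{w₂, 1} ∘ α_{w₁, s₁}` with complex filters `w₁`, `w₂` of sizes `k₁`, `k₂`. -/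
def neurovariety (k₁ k₂ s₁ : ℕ) : Set (Fin (outputSize k₁ k₂ s₁) → ℂ) :=
  {w | ∃ (w₁ : Fin k₁ → ℂ) (w₂ : Fin k₂ → ℂ),
    convolution (s₁ * 1) w = convolution 1 w₂ ∘ convolution s₁ w₁}

section Polynomials

variable {R : Type*} [CommRing R]

/-- The exponent of the monomial `x ^ a * y ^ b`, where `x = X 0` and `y = X 1`. -/
def xyExp (a b : ℕ) : Fin 2 →₀ ℕ := Finsupp.single 0 a + Finsupp.single 1 b

/-- The map `π_s`, `w ↦ ∑_j w[j] x ^ (s (k - 1 - j)) y ^ (s j)`. -/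
def filterPoly (s : ℕ) {k : ℕ} (w : Fin k → R) : MvPolynomial (Fin 2) R :=
  ∑ j : Fin k, MvPolynomial.monomial (xyExp (s * (k - 1 - (j : ℕ))) (s * (j : ℕ))) (w j)

/-- The degree `⌊(m + 1 - i) / s⌋` of the `i`-th component (`1 ≤ i ≤ s`) of the `s`-decomposition
of a form of degree `m`. It may be `-1`; the component is then zero. -/
def decompDegree (s m i : ℕ) : ℤ := ((m : ℤ) + 1 - i) / s

/-- The `i`-th component `q_i` (`1 ≤ i ≤ s`) of the `s`-decomposition of a form `P` of degree `m`,
after the change of variables `x ^ s → x`, `y ^ s → y`. It is the form of degree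
`n = ⌊(m + 1 - i) / s⌋` whose coefficient at `x ^ (n - t) y ^ t` is the coefficient of `P` at
`x ^ (i - 1 + s (n - t)) y ^ (m - (i - 1) - s (n - t))`. -/
def decompComponent (s m i : ℕ) (P : MvPolynomial (Fin 2) R) : MvPolynomial (Fin 2) R :=
  ∑ t ∈ Finset.range (decompDegree s m i + 1).toNat,
    MvPolynomial.monomial (xyExp ((decompDegree s m i).toNat - t) t)
      (P.coeff (xyExp (i - 1 + s * ((decompDegree s m i).toNat - t))
        (m - (i - 1) - s * ((decompDegree s m i).toNat - t))))

/-- The resultant matrix `R_l` of a finite family of binary forms `q i` of (formal) degrees `n i`.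
It has `l + 1` columns, and `max (0, l - n i + 1)` rows for each `q i`: its `p`-th row
(`p = 0, 1, …`) is the coefficient vector `A_0, …, A_{n i}` of `q i`, where `A_t` is the
coefficient at `x ^ (n i - t) y ^ t`, shifted to the right by `p` places. -/
def resultantMatrix {c : ℕ} (n : Fin c → ℤ) (q : Fin c → MvPolynomial (Fin 2) R) (l : ℤ) :
    Matrix (Σ i : Fin c, Fin (l - n i + 1).toNat) (Fin (l + 1).toNat) R :=
  fun row col =>
    if (row.2 : ℕ) ≤ (col : ℕ) ∧ (((col : ℕ) - (row.2 : ℕ) : ℕ) : ℤ) ≤ n row.1 then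
      (q row.1).coeff (xyExp ((n row.1).toNat - ((col : ℕ) - (row.2 : ℕ)))
        ((col : ℕ) - (row.2 : ℕ)))
    else 0

/-- The ideal generated by all minors of size `t` of a matrix. -/
def minorsIdeal {α β : Type*} (A : Matrix α β R) (t : ℕ) : Ideal R :=
  Ideal.span {d | ∃ (f : Fin t ↪ α) (g : Fin t ↪ β), d = (A.submatrix f g).det}

end Polynomials

/-- `n^* = ⌊(k - 1) / s₁⌋`, the largest of the degrees of `q_1, …, q_{s₁}`. -/
def nStar (k₁ k₂ s₁ : ℕ) : ℤ := ((outputSize k₁ k₂ s₁ : ℤ) - 1) / s₁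

/-- The number `r` of those `q_1, …, q_{s₁}` that have degree `n^*`. As the degrees
`⌊(k - i) / s₁⌋` decrease with `i`, these are `q_1, …, q_r`. -/
def rStar (k₁ k₂ s₁ : ℕ) : ℕ :=
  ((Finset.Icc 1 s₁).filter
    (fun i => decompDegree s₁ (outputSize k₁ k₂ s₁ - 1) i = nStar k₁ k₂ s₁)).card

/-- The form of degree `k - 1` with indeterminate coefficients `w[0], …, w[k-1]`. -/
def genericPoly (k : ℕ) : MvPolynomial (Fin 2) (MvPolynomial (Fin k) ℂ) :=
  filterPoly 1 (fun j => MvPolynomial.X j)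

/-- The resultant matrix `R_l` of the first `c` components `q_1, …, q_c` of the `s₁`-decomposition
of the generic form of degree `k - 1`. -/
def genericResultantMatrix (k₁ k₂ s₁ c : ℕ) (l : ℤ) :=
  resultantMatrix
    (fun i : Fin c => decompDegree s₁ (outputSize k₁ k₂ s₁ - 1) ((i : ℕ) + 1))
    (fun i : Fin c => decompComponent s₁ (outputSize k₁ k₂ s₁ - 1) ((i : ℕ) + 1)
      (genericPoly (outputSize k₁ k₂ s₁))) l

/-- The ideal `I₁`: all minors of size `2 n^* - 2 k₂ + 3` of the matrix `R_{2 n^* - k₂}` of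
`q_1, …, q_{s₁}`. -/
def idealOne (k₁ k₂ s₁ : ℕ) : Ideal (MvPolynomial (Fin (outputSize k₁ k₂ s₁)) ℂ) :=
  minorsIdeal (genericResultantMatrix k₁ k₂ s₁ s₁ (2 * nStar k₁ k₂ s₁ - k₂))
    (2 * nStar k₁ k₂ s₁ - 2 * k₂ + 3).toNat

/-- The ideal `I₂`: all minors of size `2 n^* - 2 k₂ + 4` of the matrix `R_{2 n^* - k₂ + 1}` of
`q_1, …, q_r`. -/
def idealTwo (k₁ k₂ s₁ : ℕ) : Ideal (MvPolynomial (Fin (outputSize k₁ k₂ s₁)) ℂ) :=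
  minorsIdeal (genericResultantMatrix k₁ k₂ s₁ (rStar k₁ k₂ s₁) (2 * nStar k₁ k₂ s₁ - k₂ + 1))
    (2 * nStar k₁ k₂ s₁ - 2 * k₂ + 4).toNat

end

open Polynomial

/-! Setting `x = 1` turns forms into polynomials in one variable. A composition of convolutions is
the product `w₁(X) * w₂(X ^ s)`. Sorting exponents modulo `s`, `w` lies in the neurovariety iff its
components `p i` have a common factor of degree at most `d = k₂ - 1`, with cofactors of degree below
`compSize k₁ s i` (`mem_neurovariety_iff_hasCommonFactor`). Bounding the degrees of both factors
takes care of common roots at infinity.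

Put `c = ⌊(k₁ - 1) / s₁⌋`. Then `n^* = c + d`, and the minors have sizes `2c + 1` and `2c + 2`. A
common factor `D` confines the rows to multiples of `D` by a space of dimension less than the minor
size, so the minors vanish (`HasCommonFactor.minor_eq_zero`).

Conversely, fix `p j ≠ 0`. Vanishing minors give, for each `f` in the span of shifts of the `p i`, a
syzygy of low degree between `p j` and `f`, hence a divisor of `f` built from roots of `p j`. There
are finitely many such divisors, and a complex vector space is not a finite union of proper
subspaces, so one divisor serves all `f` (`IsShiftMatrix.hasCommonFactor`). The count for the first
ideal works if `j` can be chosen among the components of lower degree; if those all vanish, the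
second ideal takes over. -/

/-! ### Minors and row spaces -/

theorem exists_linearIndependent_row_embedding {α n : Type*} [Finite n] (A : Matrix α n ℂ) (t : ℕ)
    (h : t ≤ Module.finrank ℂ (Submodule.span ℂ (Set.range A))) :
    ∃ f : Fin t ↪ α, LinearIndependent ℂ (fun i => A (f i)) := by
  obtain ⟨κ, a, ha, hsp, hli⟩ := exists_linearIndependent' ℂ A
  have : Finite κ := hli.finite
  have : Fintype κ := Fintype.ofFinite κ
  rw [← hsp, finrank_span_eq_card hli] at h
  obtain ⟨e⟩ : Nonempty (Fin t ↪ κ) :=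
    Function.Embedding.nonempty_of_card_le (by simpa using h)
  exact ⟨e.trans ⟨a, ha⟩, hli.comp e e.injective⟩

/-- A matrix whose rows span a space of dimension at least `t` has a nonzero minor of size `t`. -/
theorem exists_minor_ne_zero {α n : Type*} [Fintype n] (A : Matrix α n ℂ) (t : ℕ)
    (h : t ≤ Module.finrank ℂ (Submodule.span ℂ (Set.range A))) :
    ∃ (f : Fin t ↪ α) (g : Fin t ↪ n), (A.submatrix f g).det ≠ 0 := by
  obtain ⟨f, hf⟩ := exists_linearIndependent_row_embedding A t h
  have hr : (A.submatrix f id).rank = t := by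
    have := LinearIndependent.rank_matrix (M := A.submatrix f id) hf
    simpa using this
  rw [← Matrix.rank_transpose, Matrix.rank_eq_finrank_span_row] at hr
  obtain ⟨g, hg⟩ := exists_linearIndependent_row_embedding (A.submatrix f id).transpose t hr.ge
  refine ⟨f, g, ?_⟩
  have hu : IsUnit ((A.submatrix f g).transpose) :=
    Matrix.linearIndependent_rows_iff_isUnit.mp hg
  rw [← Matrix.det_transpose]
  exact ((Matrix.isUnit_iff_isUnit_det _).mp hu).ne_zero

/-- Minors of size larger than the dimension of a space containing the rows vanish. -/
theorem minor_eq_zero_of_finrank_lt {α n : Type*} [Fintype n] (A : Matrix α n ℂ) (t : ℕ)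
    (W : Submodule ℂ (n → ℂ)) (hA : ∀ i, A i ∈ W) (h : Module.finrank ℂ W < t)
    (f : Fin t → α) (g : Fin t → n) : (A.submatrix f g).det = 0 := by
  by_contra hd
  have hli : LinearIndependent ℂ (A.submatrix f g).row :=
    Matrix.linearIndependent_rows_iff_isUnit.mpr
      ((Matrix.isUnit_iff_isUnit_det _).mpr (isUnit_iff_ne_zero.mpr hd))
  have h2 : LinearIndependent ℂ (fun i => A (f i)) :=
    LinearIndependent.of_comp (LinearMap.funLeft ℂ ℂ g) hli
  have h3 : LinearIndependent ℂ (fun i => (⟨A (f i), hA _⟩ : W)) :=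
    LinearIndependent.of_comp W.subtype h2
  have := h3.fintype_card_le_finrank
  simp at this
  omega

/-! ### Syzygies and common factors of polynomials -/

instance finite_degreeLT (n : ℕ) : Module.Finite ℂ (degreeLT ℂ n) :=
  Module.Finite.equiv (degreeLTEquiv ℂ n).symm

theorem finrank_degreeLT (n : ℕ) : Module.finrank ℂ (degreeLT ℂ n) = n := by
  rw [LinearEquiv.finrank_eq (degreeLTEquiv ℂ n)]; simp

/-- The multiples `h * g` of `h` with `deg g < A`. -/
noncomputable def multiplesLT (h : ℂ[X]) (A : ℕ) : Submodule ℂ ℂ[X] :=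
  (degreeLT ℂ A).map (LinearMap.mulLeft ℂ h)

theorem mem_multiplesLT {h f : ℂ[X]} {A : ℕ} :
    f ∈ multiplesLT h A ↔ ∃ g : ℂ[X], g.degree < A ∧ h * g = f := by
  simp [multiplesLT, Polynomial.mem_degreeLT]

instance finite_multiplesLT (h : ℂ[X]) (A : ℕ) : Module.Finite ℂ (multiplesLT h A) :=
  inferInstanceAs (Module.Finite ℂ ((degreeLT ℂ A).map (LinearMap.mulLeft ℂ h)))

theorem finrank_multiplesLT_le (h : ℂ[X]) (A : ℕ) :
    Module.finrank ℂ (multiplesLT h A) ≤ A :=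
  (Submodule.finrank_map_le _ _).trans (finrank_degreeLT A).le

/-- After division by the gcd, coprimality makes the cofactor `b` of `f₂` divide `u`, which bounds
its degree. Taking the divisor from the roots of `f₁` leaves finitely many candidates, independent
of `f₂`. -/
theorem exists_common_divisor_of_syzygy {f₁ f₂ u v : ℂ[X]} {A d : ℕ} (h₁ : f₁ ≠ 0)
    (h₂ : f₂.degree < (A + d : ℕ)) (hu : u.degree < A) (huv : u ≠ 0 ∨ v ≠ 0)
    (h : u * f₁ + v * f₂ = 0) :
    ∃ M ≤ f₁.roots, M.card ≤ d ∧ f₂ ∈ multiplesLT (M.map (fun a => X - C a)).prod A := by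
  have hv : v ≠ 0 := by
    rintro rfl
    simp [h₁] at h
    simp [h] at huv
  obtain ⟨a, b, hab, ha, hb⟩ : ∃ a b : ℂ[X], IsCoprime a b ∧
      f₁ = EuclideanDomain.gcd f₁ f₂ * a ∧ f₂ = EuclideanDomain.gcd f₁ f₂ * b := by
    obtain ⟨a, ha⟩ := EuclideanDomain.gcd_dvd_left f₁ f₂
    obtain ⟨b, hb⟩ := EuclideanDomain.gcd_dvd_right f₁ f₂
    refine ⟨a, b, ?_, ha, hb⟩
    have hG : EuclideanDomain.gcd f₁ f₂ ≠ 0 := fun h0 => h₁ (by rw [ha, h0, zero_mul])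
    refine ⟨EuclideanDomain.gcdA f₁ f₂, EuclideanDomain.gcdB f₁ f₂, mul_left_cancel₀ hG ?_⟩
    have := EuclideanDomain.gcd_eq_gcd_ab f₁ f₂
    linear_combination (-EuclideanDomain.gcdA f₁ f₂) * ha - EuclideanDomain.gcdB f₁ f₂ * hb - this
  set G := EuclideanDomain.gcd f₁ f₂ with hGdef
  clear_value G
  have hG : G ≠ 0 := fun h0 => h₁ (by rw [ha, h0, zero_mul])
  have hrel : u * a + v * b = 0 := by
    apply mul_left_cancel₀ hG
    linear_combination h - u * ha - v * hb
  have hbu : b ∣ u := hab.symm.dvd_of_dvd_mul_right ⟨-v, by linear_combination hrel⟩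
  have hbdeg : b.degree < A := by
    by_cases hu0 : u = 0
    · have : b = 0 := by simpa [hu0, hv] using hrel
      simp [this, bot_lt_iff_ne_bot]
    · exact (degree_le_of_dvd hbu hu0).trans_lt hu
  have hroots : G.roots ≤ f₁.roots := Polynomial.roots.le_of_dvd h₁ ⟨a, ha⟩
  have hsplit : C G.leadingCoeff * (G.roots.map (fun a => X - C a)).prod = G :=
    ((IsAlgClosed.splits G).eq_prod_roots).symm
  by_cases hcard : G.roots.card ≤ d
  · refine ⟨G.roots, hroots, hcard, mem_multiplesLT.mpr ⟨C G.leadingCoeff * b, ?_, ?_⟩⟩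
    · rwa [degree_C_mul (by simpa using hG)]
    · rw [hb]
      linear_combination b * hsplit
  -- Too many common roots: keep exactly `d` of them. The cofactor then has degree below `A` because
  -- `f₂` has degree below `A + d`.
  · obtain ⟨M, hM⟩ := Multiset.card_pos_iff_exists_mem.mp
      (by rw [Multiset.card_powersetCard]; exact Nat.choose_pos (by omega : d ≤ G.roots.card))
    obtain ⟨hM, hMc⟩ := Multiset.mem_powersetCard.mp hM
    obtain ⟨N, hN⟩ := Multiset.le_iff_exists_add.mp hM
    have hf : (M.map (fun a => X - C a)).prod *
        (C G.leadingCoeff * (N.map (fun a => X - C a)).prod * b) = f₂ := by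
      rw [hN, Multiset.map_add, Multiset.prod_add] at hsplit
      linear_combination b * hsplit - hb
    refine ⟨M, hM.trans hroots, hMc.le, mem_multiplesLT.mpr
      ⟨C G.leadingCoeff * (N.map (fun a => X - C a)).prod * b, ?_, hf⟩⟩
    have hMd : ((M.map (fun a => X - C a)).prod).degree = ((d : ℕ) : WithBot ℕ) := by
      rw [degree_eq_natDegree (monic_multisetProd_X_sub_C M).ne_zero,
        natDegree_multiset_prod_X_sub_C_eq_card, hMc]
    rw [← hf, degree_mul, hMd, Nat.cast_add, add_comm] at h₂
    exact lt_of_add_lt_add_right h₂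

/-- If every element of `U` has a syzygy with `f₁` of low degree, then the elements of `U` have
a common factor. -/
theorem exists_common_factor {f₁ : ℂ[X]} {A d : ℕ} (h₁ : f₁ ≠ 0) (U : Submodule ℂ ℂ[X])
    (hU : ∀ f ∈ U, f.degree < (A + d : ℕ))
    (h : ∀ f ∈ U, ∃ u v : ℂ[X], u.degree < A ∧ (u ≠ 0 ∨ v ≠ 0) ∧ u * f₁ + v * f = 0) :
    ∃ D : ℂ[X], D ≠ 0 ∧ D.natDegree ≤ d ∧ U ≤ multiplesLT D A := by
  let ι := {M : Multiset ℂ // M ∈ f₁.roots.powerset.toFinset ∧ M.card ≤ d}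
  let D : ι → ℂ[X] := fun M => (M.1.map (fun a => X - C a)).prod
  have : Finite ι := 
    (Finset.finite_toSet f₁.roots.powerset.toFinset).subset
      (t := {M | M ∈ f₁.roots.powerset.toFinset ∧ M.card ≤ d}) fun M hM => hM.1
  -- `U` is covered by finitely many subspaces, one for each candidate divisor; as `ℂ` is infinite,
  -- one of them is all of `U`.
  obtain ⟨M, hM⟩ := Subspace.exists_eq_top_of_iUnion_eq_univ
    (p := fun M : ι => (multiplesLT (D M) A).comap U.subtype) (by
      rw [Set.eq_univ_iff_forall]
      rintro ⟨f, hf⟩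
      obtain ⟨u, v, hu, huv, hs⟩ := h f hf
      obtain ⟨M, hM, hc, hm⟩ := exists_common_divisor_of_syzygy h₁ (hU f hf) hu huv hs
      exact Set.mem_iUnion.mpr ⟨⟨M, by simpa using hM, hc⟩, hm⟩)
  refine ⟨D M, (monic_multisetProd_X_sub_C _).ne_zero, ?_, ?_⟩
  · simpa [D] using M.2.2
  · intro f hf
    have : (⟨f, hf⟩ : U) ∈ (multiplesLT (D M) A).comap U.subtype := hM ▸ Submodule.mem_top
    exact this

/-! ### Common factors and shift matrices -/

/-- The polynomials `p i` have a common factor `D` of degree at most `d`, with cofactors of degree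
less than `A i`. -/
def HasCommonFactor {ι : Type*} (p : ι → ℂ[X]) (A : ι → ℕ) (d : ℕ) : Prop :=
  ∃ (D : ℂ[X]) (g : ι → ℂ[X]), D.degree < (d + 1 : ℕ) ∧ ∀ i, (g i).degree < A i ∧ p i = D * g i

/-- The rows of `B` are the coefficient vectors of the shifts `X ^ a * p i`. -/
def IsShiftMatrix {ι : Type*} (p : ι → ℂ[X]) {ρ : ι → ℕ} {L : ℕ}
    (B : Matrix (Σ i, Fin (ρ i)) (Fin L) ℂ) : Prop :=
  ∀ row, B row = toFn L (X ^ (row.2 : ℕ) * p row.1)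

theorem HasCommonFactor.minor_eq_zero {ι : Type*} {p : ι → ℂ[X]} {A : ι → ℕ} {d : ℕ}
    (h : HasCommonFactor p A d) {ρ : ι → ℕ} {L : ℕ} {B : Matrix (Σ i, Fin (ρ i)) (Fin L) ℂ}
    (hB : IsShiftMatrix p B) {t : ℕ} (ht : ∀ i, A i + ρ i ≤ t) (ht0 : 0 < t)
    (f : Fin t → Σ i, Fin (ρ i)) (g : Fin t → Fin L) : (B.submatrix f g).det = 0 := by
  obtain ⟨D, q, -, hq⟩ := h
  refine minor_eq_zero_of_finrank_lt B t ((multiplesLT D (t - 1)).map (toFn L)) ?_ ?_ f g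
  · rintro ⟨i, a⟩
    rw [hB]
    refine Submodule.mem_map_of_mem (mem_multiplesLT.mpr ⟨X ^ (a : ℕ) * q i, ?_, ?_⟩)
    · by_cases h0 : q i = 0
      · simp [h0, bot_lt_iff_ne_bot]
      · have h1 := (hq i).1
        have ha := a.2
        have := ht i
        rw [degree_eq_natDegree h0, Nat.cast_lt] at h1
        rw [degree_mul, degree_X_pow, degree_eq_natDegree h0, ← Nat.cast_add, Nat.cast_lt]
        omega
    · rw [(hq i).2]; ring
  · have h1 : Module.finrank ℂ ((multiplesLT D (t - 1)).map (toFn L)) ≤ t - 1 :=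
      (Submodule.finrank_map_le _ _).trans (finrank_multiplesLT_le D (t - 1))
    omega

theorem IsShiftMatrix.toFn_mul_mem {ι : Type*} {p : ι → ℂ[X]} {ρ : ι → ℕ} {L : ℕ}
    {B : Matrix (Σ i, Fin (ρ i)) (Fin L) ℂ} (hB : IsShiftMatrix p B) (i : ι) {u : ℂ[X]}
    (hu : u.degree < ρ i) : toFn L (u * p i) ∈ Submodule.span ℂ (Set.range B) := by
  classical
  rw [← mem_degreeLT, degreeLT_eq_span_X_pow] at hu
  induction hu using Submodule.span_induction with
  | mem x hx =>
    simp only [Finset.coe_image, Finset.coe_range, Set.mem_image, Set.mem_Iio] at hx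
    obtain ⟨a, ha, rfl⟩ := hx
    exact Submodule.subset_span ⟨⟨i, ⟨a, ha⟩⟩, hB _⟩
  | zero => simp
  | add x y _ _ hx hy => rw [add_mul, map_add]; exact Submodule.add_mem _ hx hy
  | smul c x _ hx => rw [smul_mul_assoc, map_smul]; exact Submodule.smul_mem _ _ hx

theorem eq_zero_of_toFn_eq_zero {L : ℕ} {f : ℂ[X]} (hf : f.degree < L) (h : toFn L f = 0) :
    f = 0 := by
  ext n
  by_cases hn : n < L
  · exact congrFun h ⟨n, hn⟩
  · exact coeff_eq_zero_of_degree_lt (hf.trans_le (by exact_mod_cast not_lt.mp hn))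

theorem degree_mul_lt_of_lt {u f : ℂ[X]} {a b L : ℕ} (hu : u.degree < a) (hf : f.degree < b)
    (h : a + b ≤ L + 1) : (u * f).degree < L := by
  by_cases hu0 : u = 0
  · simp [hu0, bot_lt_iff_ne_bot]
  by_cases hf0 : f = 0
  · simp [hf0, bot_lt_iff_ne_bot]
  rw [degree_mul]
  rw [degree_eq_natDegree hu0, Nat.cast_lt] at hu
  rw [degree_eq_natDegree hf0, Nat.cast_lt] at hf
  rw [degree_eq_natDegree hf0, degree_eq_natDegree hu0, ← Nat.cast_add, Nat.cast_lt]
  omega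

/-- The pairs `(u, v)` form a space of dimension `a + b`, which exceeds the rank of `B`, so `(u, v)
↦ u * f₁ + v * f₂` has a kernel; the degree bounds ensure that `toFn L` truncates nothing. -/
theorem exists_syzygy {α : Type*} {L : ℕ} (B : Matrix α (Fin L) ℂ) {a b : ℕ}
    (hB : ∀ (f : Fin (a + b) ↪ α) (g : Fin (a + b) ↪ Fin L), (B.submatrix f g).det = 0)
    {f₁ f₂ : ℂ[X]}
    (h₁ : ∀ u : ℂ[X], u.degree < a → toFn L (u * f₁) ∈ Submodule.span ℂ (Set.range B))
    (h₂ : ∀ v : ℂ[X], v.degree < b → toFn L (v * f₂) ∈ Submodule.span ℂ (Set.range B))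
    (hd₁ : ∀ u : ℂ[X], u.degree < a → (u * f₁).degree < L)
    (hd₂ : ∀ v : ℂ[X], v.degree < b → (v * f₂).degree < L) :
    ∃ u v : ℂ[X], u.degree < a ∧ (u ≠ 0 ∨ v ≠ 0) ∧ u * f₁ + v * f₂ = 0 := by
  have hrank : Module.finrank ℂ (Submodule.span ℂ (Set.range B)) < a + b := by
    by_contra! hle
    obtain ⟨f, g, hfg⟩ := exists_minor_ne_zero B (a + b) hle
    exact hfg (hB f g)
  let φ : (degreeLT ℂ a × degreeLT ℂ b) →ₗ[ℂ] ℂ[X] :=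
    ((LinearMap.mulRight ℂ f₁).comp (degreeLT ℂ a).subtype).coprod
      ((LinearMap.mulRight ℂ f₂).comp (degreeLT ℂ b).subtype)
  have hφ : ∀ x, φ x = x.1 * f₁ + x.2 * f₂ := fun x => by simp [φ]
  let ψ := ((toFn L).comp φ).codRestrict (Submodule.span ℂ (Set.range B)) (fun x => by
    rw [LinearMap.comp_apply, hφ, map_add]
    exact Submodule.add_mem _ (h₁ _ (mem_degreeLT.mp x.1.2)) (h₂ _ (mem_degreeLT.mp x.2.2)))
  have hker : LinearMap.ker ψ ≠ ⊥ := by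
    apply LinearMap.ker_ne_bot_of_finrank_lt
    rwa [Module.finrank_prod, finrank_degreeLT, finrank_degreeLT]
  obtain ⟨x, hx, hx0⟩ := Submodule.exists_mem_ne_zero_of_ne_bot hker
  refine ⟨x.1, x.2, mem_degreeLT.mp x.1.2, ?_, ?_⟩
  · by_contra! hc
    exact hx0 (Prod.ext (Subtype.ext hc.1) (Subtype.ext hc.2))
  · apply eq_zero_of_toFn_eq_zero (L := L)
    · exact (degree_add_le _ _).trans_lt
        (max_lt (hd₁ _ (mem_degreeLT.mp x.1.2)) (hd₂ _ (mem_degreeLT.mp x.2.2)))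
    · rw [← hφ]
      exact congrArg Subtype.val (LinearMap.mem_ker.mp hx)

/-- If the maximal-size minors of a shift matrix vanish, the polynomials have a common factor. -/
theorem IsShiftMatrix.hasCommonFactor {ι : Type*} {p : ι → ℂ[X]} {A : ι → ℕ} {d : ℕ}
    {ρ : ι → ℕ} {L : ℕ} {B : Matrix (Σ i, Fin (ρ i)) (Fin L) ℂ} (hS : IsShiftMatrix p B)
    (hp : ∀ i, (p i).degree < (A i + d : ℕ)) {E b : ℕ} (hAE : ∀ i, A i ≤ E)
    {j : ι} (hj : p j ≠ 0) (hρj : E ≤ ρ j) (hρ : ∀ i, b + E ≤ ρ i + A i)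
    (hLj : E + (A j + d) ≤ L + 1) (hL : b + (E + d) ≤ L + 1)
    {t : ℕ} (ht : t = E + b)
    (hB : ∀ (f : Fin t ↪ Σ i, Fin (ρ i)) (g : Fin t ↪ Fin L), (B.submatrix f g).det = 0) :
    HasCommonFactor p A d := by
  subst ht
  -- All shifts up to the common bound `E + d`: the unshifted `p i` yields divisibility, and the top
  -- shift by `E - A i` recovers the individual bound `A i` on the cofactor.
  let T : Set ℂ[X] := {f | ∃ i, ∃ m : ℕ, m + A i ≤ E ∧ f = X ^ m * p i}
  have hTdeg : ∀ f ∈ Submodule.span ℂ T, f.degree < (E + d : ℕ) := by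
    have : Submodule.span ℂ T ≤ degreeLT ℂ (E + d) := by
      rw [Submodule.span_le]
      rintro _ ⟨i, m, hm, rfl⟩
      exact mem_degreeLT.mpr (degree_mul_lt_of_lt (a := m + 1) (b := A i + d)
        (by rw [degree_X_pow]; exact_mod_cast Nat.lt_succ_self m) (hp i) (by omega))
    exact fun f hf => mem_degreeLT.mp (this hf)
  have hTmem : ∀ f ∈ Submodule.span ℂ T, ∀ v : ℂ[X], v.degree < b →
      toFn L (v * f) ∈ Submodule.span ℂ (Set.range B) := by
    intro f hf v hv
    induction hf using Submodule.span_induction with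
    | mem x hx =>
      obtain ⟨i, m, hm, rfl⟩ := hx
      rw [← mul_assoc]
      refine hS.toFn_mul_mem i (degree_mul_lt_of_lt (b := m + 1) hv ?_ ?_)
      · rw [degree_X_pow]; exact_mod_cast Nat.lt_succ_self m
      · have := hρ i
        omega
    | zero => simp
    | add x y _ _ hx hy => rw [mul_add, map_add]; exact Submodule.add_mem _ hx hy
    | smul c x _ hx => rw [mul_smul_comm, map_smul]; exact Submodule.smul_mem _ _ hx
  obtain ⟨D, hD, hDd, hU⟩ := exists_common_factor (A := E) (d := d) hj (Submodule.span ℂ T) hTdeg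
    (fun f hf => exists_syzygy B hB
      (fun u hu => hS.toFn_mul_mem j (hu.trans_le (by exact_mod_cast hρj))) (hTmem f hf)
      (fun u hu => degree_mul_lt_of_lt hu (hp j) hLj)
      (fun v hv => degree_mul_lt_of_lt hv (hTdeg f hf) hL))
  have key : ∀ i, ∃ g : ℂ[X], g.degree < A i ∧ p i = D * g := by
    intro i
    obtain ⟨g, -, hg⟩ := mem_multiplesLT.mp
      (hU (Submodule.subset_span ⟨i, 0, by simpa using hAE i, rfl⟩))
    obtain ⟨g', hg'E, hg'⟩ := mem_multiplesLT.mp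
      (hU (Submodule.subset_span ⟨i, E - A i, by have := hAE i; omega, rfl⟩))
    rw [pow_zero, one_mul] at hg
    have hgg : g' = X ^ (E - A i) * g := mul_left_cancel₀ hD (by rw [hg', ← hg]; ring)
    refine ⟨g, ?_, hg.symm⟩
    by_cases h0 : g = 0
    · simp [h0, bot_lt_iff_ne_bot]
    · rw [hgg, degree_mul, degree_X_pow, degree_eq_natDegree h0, ← Nat.cast_add, Nat.cast_lt]
        at hg'E
      rw [degree_eq_natDegree h0, Nat.cast_lt]
      have := hAE i
      omega
  choose g hg using key
  refine ⟨D, g, ?_, hg⟩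
  rw [degree_eq_natDegree hD, Nat.cast_lt]
  omega

/-! ### Residue classes of exponents -/

section Progression

/-- The polynomial whose `n`-th coefficient is the coefficient of `P` of index `s * n + a`. -/
noncomputable def progression (s a : ℕ) (P : ℂ[X]) : ℂ[X] :=
  ∑ n ∈ Finset.range (P.natDegree + 1), monomial n (P.coeff (s * n + a))

theorem coeff_progression {s : ℕ} (hs : 0 < s) (a : ℕ) (P : ℂ[X]) (n : ℕ) :
    (progression s a P).coeff n = P.coeff (s * n + a) := by
  simp only [progression, finsetSum_coeff, coeff_monomial, Finset.sum_ite_eq', Finset.mem_range]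
  split_ifs with h
  · rfl
  · refine (coeff_eq_zero_of_natDegree_lt ?_).symm
    nlinarith

theorem progression_mul_expand {s a : ℕ} (ha : a < s) (P W : ℂ[X]) :
    progression s a (P * expand ℂ s W) = progression s a P * W := by
  have hs : 0 < s := by omega
  induction W using Polynomial.induction_on' with
  | add p q hp hq =>
    rw [mul_add, ← hp, ← hq, map_add, mul_add]
    ext n
    simp [coeff_progression hs]
  | monomial n c =>
    ext t
    rw [coeff_progression hs, expand_monomial, ← C_mul_X_pow_eq_monomial,
      ← C_mul_X_pow_eq_monomial, mul_left_comm, mul_left_comm _ (C c), coeff_C_mul, coeff_C_mul,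
      coeff_mul_X_pow', coeff_mul_X_pow', coeff_progression hs]
    congr 1
    -- This is where `a < s` enters: the offset cannot reach the next multiple of `s`.
    have hiff : n * s ≤ s * t + a ↔ n ≤ t := by
      rw [mul_comm n s]
      constructor
      · intro h
        by_contra! hlt
        have := Nat.mul_le_mul_left s hlt
        rw [Nat.succ_eq_add_one, mul_add] at this
        omega
      · intro h
        have := Nat.mul_le_mul_left s h
        omega
    by_cases hn : n ≤ t
    · rw [if_pos hn, if_pos (hiff.mpr hn)]
      congr 1
      rw [Nat.mul_sub, mul_comm n s]
      have := Nat.mul_le_mul_left s hn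
      omega
    · rw [if_neg hn, if_neg (fun h => hn (hiff.mp h))]

theorem eq_of_progression_eq {s : ℕ} (hs : 0 < s) {P Q : ℂ[X]}
    (h : ∀ a < s, progression s a P = progression s a Q) : P = Q := by
  ext n
  have := congrArg (fun f => f.coeff (n / s)) (h (n % s) (Nat.mod_lt _ hs))
  simpa [coeff_progression hs, Nat.div_add_mod] using this

end Progression

/-! ### Convolutions as polynomial products -/

section Convolution

/-- The pairing of polynomials with sequences, `X ^ n ↦ x n`. -/
noncomputable def seqPairing (x : ℕ → ℂ) : ℂ[X] →ₗ[ℂ] ℂ :=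
  Polynomial.lsum fun n => x n • LinearMap.id

theorem seqPairing_monomial (x : ℕ → ℂ) (n : ℕ) (c : ℂ) :
    seqPairing x (monomial n c) = x n * c := by
  simp [seqPairing, Polynomial.lsum_apply]

theorem convolution_eq_seqPairing (s : ℕ) {k : ℕ} (w : Fin k → ℂ) (x : ℕ → ℂ) (i : ℕ) :
    convolution s w x i = seqPairing x (ofFn k w * X ^ (i * s)) := by
  rw [ofFn_eq_sum_monomial, Finset.sum_mul, map_sum, convolution]
  refine Finset.sum_congr rfl fun j _ => ?_
  rw [monomial_mul_X_pow, seqPairing_monomial, mul_comm, add_comm]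

theorem convolution_comp_eq_seqPairing (s : ℕ) {k₁ k₂ : ℕ} (w₁ : Fin k₁ → ℂ) (w₂ : Fin k₂ → ℂ)
    (x : ℕ → ℂ) (i : ℕ) :
    (convolution 1 w₂ ∘ convolution s w₁) x i =
      seqPairing x (ofFn k₁ w₁ * expand ℂ s (ofFn k₂ w₂) * X ^ (i * s)) := by
  rw [ofFn_eq_sum_monomial w₂, map_sum, Finset.mul_sum, Finset.sum_mul, map_sum,
    Function.comp_apply, convolution]
  refine Finset.sum_congr rfl fun j _ => ?_
  rw [convolution_eq_seqPairing, ← smul_eq_mul, ← map_smul, expand_monomial,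
    ← C_mul_X_pow_eq_monomial, ← C_mul']
  congr 1
  ring

/-- Indicator sequences read off the coefficients. -/
theorem eq_of_seqPairing_eq {P Q : ℂ[X]} (h : ∀ x, seqPairing x P = seqPairing x Q) : P = Q := by
  have key : ∀ (P : ℂ[X]) (n : ℕ), seqPairing (Pi.single n 1) P = P.coeff n := by
    intro P n
    induction P using Polynomial.induction_on' with
    | add p q hp hq => rw [map_add, hp, hq, coeff_add]
    | monomial m c =>
      rw [seqPairing_monomial, coeff_monomial, Pi.single_apply, ite_mul, one_mul, zero_mul]
  ext n
  rw [← key, h, key]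

theorem mem_neurovariety_iff {k₁ k₂ s : ℕ} {w : Fin (outputSize k₁ k₂ s) → ℂ} :
    w ∈ neurovariety k₁ k₂ s ↔ ∃ (w₁ : Fin k₁ → ℂ) (w₂ : Fin k₂ → ℂ),
      ofFn _ w = ofFn k₁ w₁ * expand ℂ s (ofFn k₂ w₂) := by
  refine exists_congr fun w₁ => exists_congr fun w₂ => ⟨fun h => ?_, fun h => ?_⟩
  · refine eq_of_seqPairing_eq fun x => ?_
    have := congrFun (congrFun h x) 0
    rw [convolution_eq_seqPairing, convolution_comp_eq_seqPairing] at this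
    simpa using this
  · funext x i
    rw [convolution_eq_seqPairing, convolution_comp_eq_seqPairing, h, mul_one]

end Convolution

/-! ### The neurovariety in terms of components -/

section Components

/-- The number `⌈(k₁ - i) / s⌉` of indices below `k₁` in the residue class of the component of
(zero-based) index `i`. -/
def compSize (k₁ s i : ℕ) : ℕ := (k₁ + s - 1 - i) / s

/-- The residue class of the component of (zero-based) index `i`. -/
def compOffset (k₁ s i : ℕ) : ℕ := (k₁ + s - 1 - i) % s

theorem compSize_compOffset {k₁ s i : ℕ} (hi : i < s) :
    s * compSize k₁ s i + compOffset k₁ s i + i + 1 = k₁ + s := by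
  have := Nat.div_add_mod (k₁ + s - 1 - i) s
  unfold compSize compOffset
  omega

theorem compOffset_lt {k₁ s i : ℕ} (hi : i < s) : compOffset k₁ s i < s :=
  Nat.mod_lt _ (by omega)

/-- The offset is the reflection `i ↦ k₁ - 1 - i` modulo `s`: components are indexed by exponents of
`x`, filter entries by exponents of `y`. -/
theorem compOffset_compOffset {k₁ s i : ℕ} (hi : i < s) :
    compOffset k₁ s (compOffset k₁ s i) = i := by
  have h := compSize_compOffset (k₁ := k₁) hi
  have : k₁ + s - 1 - compOffset k₁ s i = s * compSize k₁ s i + i := by omega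
  rw [compOffset, this, Nat.mul_add_mod, Nat.mod_eq_of_lt hi]

theorem mul_add_compOffset_lt_iff {k₁ s i : ℕ} (hi : i < s) (t d : ℕ) :
    s * t + compOffset k₁ s i < k₁ + d * s ↔ t < compSize k₁ s i + d := by
  have h := compSize_compOffset (k₁ := k₁) hi
  constructor
  · intro hlt
    by_contra! hle
    have := Nat.mul_le_mul_left s hle
    rw [mul_add, mul_comm s d] at this
    omega
  · intro hlt
    have := Nat.mul_le_mul_left s hlt
    rw [Nat.succ_eq_add_one, mul_add, mul_add, mul_comm s d] at this
    omega

/-- The dehomogenized components of the `s`-decomposition of the filter `w`. -/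
noncomputable def filterComponent (k₁ s : ℕ) {k : ℕ} (w : Fin k → ℂ) (i : ℕ) : ℂ[X] :=
  progression s (compOffset k₁ s i) (ofFn k w)

theorem degree_filterComponent_lt {k k₁ s d : ℕ} (hk : k = k₁ + d * s) (w : Fin k → ℂ) {i : ℕ}
    (hi : i < s) :
    (filterComponent k₁ s w i).degree < (compSize k₁ s i + d : ℕ) := by
  rw [degree_lt_iff_coeff_zero]
  intro t ht
  rw [filterComponent, coeff_progression (by omega)]
  refine ofFn_coeff_eq_zero_of_ge _ ?_
  rwa [hk, ← not_lt, mul_add_compOffset_lt_iff hi, not_lt]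

theorem mem_neurovariety_iff_hasCommonFactor {k₁ d s : ℕ} (hs : 0 < s)
    (w : Fin (outputSize k₁ (d + 1) s) → ℂ) :
    w ∈ neurovariety k₁ (d + 1) s ↔
      HasCommonFactor (fun i : Fin s => filterComponent k₁ s w i) (fun i => compSize k₁ s i) d := by
  rw [mem_neurovariety_iff]
  constructor
  · rintro ⟨w₁, w₂, h⟩
    refine ⟨ofFn _ w₂, fun i => filterComponent k₁ s w₁ i, ofFn_degree_lt _, fun i => ⟨?_, ?_⟩⟩
    -- Here `d = 0` because `w₁` has size `k₁` itself.
    · simpa using degree_filterComponent_lt (d := 0) (by simp) w₁ i.2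
    · change filterComponent k₁ s w i = _
      rw [filterComponent, h, progression_mul_expand (compOffset_lt i.2), mul_comm]
      rfl
  · rintro ⟨D, g, hD, hg⟩
    -- The first filter interleaves the coefficients of the cofactors by residue class.
    refine ⟨fun l => (g ⟨compOffset k₁ s (l % s), compOffset_lt (Nat.mod_lt _ hs)⟩).coeff (l / s),
      toFn _ D, eq_of_progression_eq hs fun a ha => ?_⟩
    have hDD : ofFn (d + 1) (toFn (d + 1) D) = D := by
      ext n
      by_cases hn : n < d + 1
      · rw [ofFn_coeff_eq_val_of_lt _ hn]; rfl
      · rw [ofFn_coeff_eq_zero_of_ge _ (not_lt.mp hn), coeff_eq_zero_of_degree_lt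
          (hD.trans_le (by exact_mod_cast not_lt.mp hn))]
    obtain ⟨i, hi, rfl⟩ : ∃ i, i < s ∧ compOffset k₁ s i = a :=
      ⟨_, compOffset_lt ha, compOffset_compOffset ha⟩
    have hgi := hg ⟨i, hi⟩
    rw [progression_mul_expand ha, hDD]
    refine Eq.trans (hgi.2) ?_
    rw [mul_comm]
    congr 1
    ext t
    rw [coeff_progression hs]
    by_cases ht : t < compSize k₁ s i
    · have hlt : s * t + compOffset k₁ s i < k₁ := by
        simpa using (mul_add_compOffset_lt_iff (k₁ := k₁) hi t 0).mpr ht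
      rw [ofFn_coeff_eq_val_of_lt _ hlt]
      have h1 : (s * t + compOffset k₁ s i) % s = compOffset k₁ s i := by
        rw [Nat.mul_add_mod, Nat.mod_eq_of_lt ha]
      have h2 : (s * t + compOffset k₁ s i) / s = t := by
        rw [Nat.mul_add_div hs, Nat.div_eq_of_lt ha, add_zero]
      simp only [h1, h2, compOffset_compOffset hi]
    · rw [ofFn_coeff_eq_zero_of_ge, coeff_eq_zero_of_degree_lt]
      · exact hgi.1.trans_le (by exact_mod_cast not_lt.mp ht)
      · have := (mul_add_compOffset_lt_iff (k₁ := k₁) hi t 0)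
        simp only [zero_mul, add_zero] at this
        rwa [← not_lt, this]

end Components

/-! ### Comparison with the bivariate decomposition -/

section Decomposition

theorem xyExp_inj {a b a' b' : ℕ} : xyExp a b = xyExp a' b' ↔ a = a' ∧ b = b' := by
  constructor
  · intro h
    have h0 := DFunLike.congr_fun h 0
    have h1 := DFunLike.congr_fun h 1
    simp [xyExp] at h0 h1
    exact ⟨h0, h1⟩
  · rintro ⟨rfl, rfl⟩; rfl

variable {R : Type*} [CommRing R]

theorem coeff_filterPoly_one {k : ℕ} (w : Fin k → R) {a : ℕ} (b : Fin k) (hab : a + b = k - 1) :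
    (filterPoly 1 w).coeff (xyExp a b) = w b := by
  rw [filterPoly, MvPolynomial.coeff_sum, Finset.sum_eq_single b]
  · rw [MvPolynomial.coeff_monomial, if_pos]
    rw [xyExp_inj]
    omega
  · intro j _ hj
    rw [MvPolynomial.coeff_monomial, if_neg]
    rw [xyExp_inj]
    rintro ⟨-, h⟩
    exact hj (Fin.ext (by omega))
  · simp

variable {k₁ d s i : ℕ}

theorem decompDegree_eq {k : ℕ} (hk : k = k₁ + d * s) (hk₁ : 0 < k₁) (hi : i < s) :
    decompDegree s (k - 1) (i + 1) = (compSize k₁ s i : ℤ) + d - 1 := by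
  have h := compSize_compOffset (k₁ := k₁) hi
  have h' : (s : ℤ) * compSize k₁ s i + compOffset k₁ s i + i + 1 = k₁ + s := by exact_mod_cast h
  have hnum : (((k - 1 : ℕ) : ℤ) + 1 - (i + 1 : ℕ)) =
      compOffset k₁ s i + (s : ℤ) * (compSize k₁ s i + d - 1) := by
    rw [Nat.cast_sub (by subst hk; omega), hk]
    push_cast
    linear_combination -h'
  rw [decompDegree, hnum, Int.add_mul_ediv_left _ _ (by omega), Int.ediv_eq_zero_of_lt (by omega)
    (by exact_mod_cast compOffset_lt hi), zero_add]

theorem decompComponent_filterPoly {k : ℕ} (hk : k = k₁ + d * s) (hk₁ : 0 < k₁) (hi : i < s)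
    (w : Fin k → R) :
    decompComponent s (k - 1) (i + 1) (filterPoly 1 w) =
      ∑ t ∈ Finset.range (compSize k₁ s i + d),
        MvPolynomial.monomial (xyExp (compSize k₁ s i + d - 1 - t) t)
          (if h : s * t + compOffset k₁ s i < k then w ⟨_, h⟩ else 0) := by
  have h := compSize_compOffset (k₁ := k₁) hi
  have h1 : (compSize k₁ s i + d - 1 + 1 : ℤ).toNat = compSize k₁ s i + d := by omega
  have h2 : (compSize k₁ s i + d - 1 : ℤ).toNat = compSize k₁ s i + d - 1 := by omega
  rw [decompComponent, decompDegree_eq hk hk₁ hi, h1, h2]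
  refine Finset.sum_congr rfl fun t ht => ?_
  rw [Finset.mem_range] at ht
  have hlt := (mul_add_compOffset_lt_iff (k₁ := k₁) hi t d).mpr ht
  rw [← hk] at hlt
  rw [dif_pos hlt]
  congr 1
  obtain ⟨q, hq⟩ := Nat.exists_eq_add_of_lt ht
  have hq' : compSize k₁ s i + d - 1 - t = q := by omega
  have hmul : s * compSize k₁ s i + s * d = s * t + s * q + s := by
    rw [← mul_add, hq]; ring
  rw [mul_comm s d] at hmul
  rw [hq']
  have e1 : k - 1 - (i + 1 - 1) - s * q = s * t + compOffset k₁ s i := by omega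
  rw [e1]
  exact coeff_filterPoly_one w ⟨_, hlt⟩ (by simp only; omega)

theorem coeff_decompComponent_filterPoly {k : ℕ} (hk : k = k₁ + d * s) (hk₁ : 0 < k₁) (hi : i < s)
    (w : Fin k → R) {t : ℕ} (ht : s * t + compOffset k₁ s i < k) :
    (decompComponent s (k - 1) (i + 1) (filterPoly 1 w)).coeff
      (xyExp (compSize k₁ s i + d - 1 - t) t) = w ⟨_, ht⟩ := by
  rw [decompComponent_filterPoly hk hk₁ hi, MvPolynomial.coeff_sum, Finset.sum_eq_single t]
  · rw [MvPolynomial.coeff_monomial, if_pos rfl, dif_pos ht]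
  · intro j _ hj
    rw [MvPolynomial.coeff_monomial, if_neg]
    rw [xyExp_inj]
    exact fun h => hj h.2
  · intro h
    rw [hk, mul_add_compOffset_lt_iff hi] at ht
    exact absurd (Finset.mem_range.mpr ht) h

theorem decompComponent_eq_zero_iff {k : ℕ} (hk : k = k₁ + d * s) (hk₁ : 0 < k₁) (hi : i < s)
    (w : Fin k → ℂ) :
    decompComponent s (k - 1) (i + 1) (filterPoly 1 w) = 0 ↔ filterComponent k₁ s w i = 0 := by
  constructor
  · intro h
    ext t
    rw [filterComponent, coeff_progression (by omega), coeff_zero]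
    by_cases ht : s * t + compOffset k₁ s i < k
    · rw [ofFn_coeff_eq_val_of_lt _ ht, ← coeff_decompComponent_filterPoly hk hk₁ hi w ht, h,
        MvPolynomial.coeff_zero]
    · exact ofFn_coeff_eq_zero_of_ge _ (not_lt.mp ht)
  · intro h
    rw [decompComponent_filterPoly hk hk₁ hi]
    refine Finset.sum_eq_zero fun t _ => ?_
    split_ifs with ht
    · rw [← ofFn_coeff_eq_val_of_lt w ht, ← coeff_progression (by omega)]
      change MvPolynomial.monomial _ ((filterComponent k₁ s w i).coeff t) = 0
      rw [h, coeff_zero, map_zero]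
    · exact map_zero _

end Decomposition

/-! ### Specialized resultant matrices and zero loci -/

section ResultantMatrix

variable {k₁ d s : ℕ}

theorem isShiftMatrix_genericResultantMatrix (hk₁ : 0 < k₁) {c : ℕ} (hc : c ≤ s) (l : ℤ)
    (w : Fin (outputSize k₁ (d + 1) s) → ℂ) :
    IsShiftMatrix (fun i : Fin c => filterComponent k₁ s w i)
      ((genericResultantMatrix k₁ (d + 1) s c l).map (MvPolynomial.aeval w)) := by
  rintro ⟨i, a⟩
  have hi : (i : ℕ) < s := i.2.trans_le hc
  have hk : outputSize k₁ (d + 1) s = k₁ + d * s := rfl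
  funext col
  have hs : 0 < s := by omega
  change _ = (X ^ (a : ℕ) * filterComponent k₁ s w i).coeff col
  rw [coeff_X_pow_mul', Matrix.map_apply, genericResultantMatrix, resultantMatrix]
  simp only
  by_cases ha : (a : ℕ) ≤ col
  swap
  · rw [if_neg (fun h => ha h.1), if_neg ha, map_zero]
  rw [if_pos ha, filterComponent, coeff_progression hs]
  have hdeg := decompDegree_eq hk hk₁ hi
  have hiff : s * (col - a : ℕ) + compOffset k₁ s i < outputSize k₁ (d + 1) s ↔
      (col - a : ℕ) < compSize k₁ s i + d := mul_add_compOffset_lt_iff hi _ d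
  by_cases ht : s * (col - a : ℕ) + compOffset k₁ s i < outputSize k₁ (d + 1) s
  · have ht' := hiff.mp ht
    rw [if_pos ⟨ha, by omega⟩, ofFn_coeff_eq_val_of_lt _ ht]
    have h2 : (decompDegree s (outputSize k₁ (d + 1) s - 1) (i + 1)).toNat =
        compSize k₁ s i + d - 1 := by omega
    rw [h2, genericPoly, coeff_decompComponent_filterPoly hk hk₁ hi _ ht, MvPolynomial.aeval_X]
  · rw [ofFn_coeff_eq_zero_of_ge _ (not_lt.mp ht), if_neg, map_zero]
    rintro ⟨-, h⟩
    have ht' := mt hiff.mpr ht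
    omega

theorem mem_zeroLocus_minorsIdeal_iff {σ α β : Type*} (A : Matrix α β (MvPolynomial σ ℂ)) (t : ℕ)
    (x : σ → ℂ) :
    x ∈ MvPolynomial.zeroLocus ℂ (minorsIdeal A t) ↔
      ∀ (f : Fin t ↪ α) (g : Fin t ↪ β),
        ((A.map (MvPolynomial.aeval x : MvPolynomial σ ℂ →ₐ[ℂ] ℂ)).submatrix f g).det = 0 := by
  rw [minorsIdeal, MvPolynomial.zeroLocus_span]
  constructor
  · intro h f g
    rw [Matrix.submatrix_map, ← AlgHom.mapMatrix_apply, ← AlgHom.map_det]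
    exact h _ ⟨f, g, rfl⟩
  · rintro h _ ⟨f, g, rfl⟩
    have := h f g
    rwa [Matrix.submatrix_map, ← AlgHom.mapMatrix_apply, ← AlgHom.map_det] at this

theorem mem_zeroLocus_add_iff {σ : Type*} {I J : Ideal (MvPolynomial σ ℂ)} {x : σ → ℂ} :
    x ∈ MvPolynomial.zeroLocus ℂ (I + J) ↔
      x ∈ MvPolynomial.zeroLocus ℂ I ∧ x ∈ MvPolynomial.zeroLocus ℂ J := by
  constructor
  · intro h
    exact ⟨MvPolynomial.zeroLocus_anti_mono le_sup_left h,
      MvPolynomial.zeroLocus_anti_mono le_sup_right h⟩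
  · rintro ⟨hI, hJ⟩ p hp
    obtain ⟨a, ha, b, hb, rfl⟩ := Submodule.mem_sup.mp hp
    rw [map_add, hI a ha, hJ b hb, add_zero]

end ResultantMatrix

/-! ### Values of the degrees and of `r` -/

section Sizes

variable {k₁ d s : ℕ}

/-- The degree `⌊(k₁ - 1) / s⌋` of the cofactors of the components of largest degree. -/
def cofactorDegree (k₁ s : ℕ) : ℕ := (k₁ - 1) / s

theorem outputSize_succ : outputSize k₁ (d + 1) s = k₁ + d * s := rfl

theorem compSize_zero (hk₁ : 0 < k₁) (hs : 0 < s) : compSize k₁ s 0 = cofactorDegree k₁ s + 1 := by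
  rw [compSize, cofactorDegree, ← Nat.add_div_right _ hs]
  congr 1
  omega

theorem compSize_of_lt (hk₁ : 0 < k₁) {i : ℕ} (hi : i < s) (h : i < (k₁ - 1) % s + 1) :
    compSize k₁ s i = cofactorDegree k₁ s + 1 := by
  have hdm := Nat.div_add_mod (k₁ - 1) s
  rw [compSize, cofactorDegree, Nat.div_eq_iff (by omega), add_mul, mul_comm _ s]
  have := Nat.mod_lt (k₁ - 1) (show s > 0 by omega)
  omega

theorem compSize_of_ge (hk₁ : 0 < k₁) {i : ℕ} (hi : i < s) (h : (k₁ - 1) % s + 1 ≤ i) :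
    compSize k₁ s i = cofactorDegree k₁ s := by
  have hdm := Nat.div_add_mod (k₁ - 1) s
  rw [compSize, cofactorDegree, Nat.div_eq_iff (by omega), mul_comm _ s]
  have := Nat.mod_lt (k₁ - 1) (show s > 0 by omega)
  omega

theorem nStar_eq (hk₁ : 0 < k₁) (hs : 0 < s) :
    nStar k₁ (d + 1) s = (cofactorDegree k₁ s : ℤ) + d := by
  have h := decompDegree_eq (k₁ := k₁) (d := d) (s := s) (i := 0) rfl hk₁ hs
  rw [compSize_zero hk₁ hs, decompDegree, Nat.cast_sub (by omega)] at h
  rw [nStar, outputSize]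
  simp only [Nat.add_sub_cancel]
  push_cast at h ⊢
  simp only [sub_add_cancel] at h
  rw [h]
  ring

theorem rStar_eq (hk₁ : 0 < k₁) (hs : 0 < s) : rStar k₁ (d + 1) s = (k₁ - 1) % s + 1 := by
  have : (Finset.Icc 1 s).filter (fun i => decompDegree s (outputSize k₁ (d + 1) s - 1) i =
      nStar k₁ (d + 1) s) = Finset.Icc 1 ((k₁ - 1) % s + 1) := by
    have hlt := Nat.mod_lt (k₁ - 1) hs
    ext i
    rw [Finset.mem_filter, Finset.mem_Icc, Finset.mem_Icc]
    obtain _ | i := i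
    · simp
    by_cases his : i < s
    · rw [decompDegree_eq (d := d) outputSize_succ hk₁ his, nStar_eq hk₁ hs]
      by_cases h : i < (k₁ - 1) % s + 1
      · rw [compSize_of_lt hk₁ his h]
        constructor
        · intro _; omega
        · intro _; exact ⟨by omega, by push_cast; ring⟩
      · rw [compSize_of_ge hk₁ his (not_lt.mp h)]
        constructor
        · rintro ⟨-, h⟩; omega
        · intro _; omega
    · constructor
      · rintro ⟨h, -⟩; omega
      · intro h; omega
  rw [rStar, this, Nat.card_Icc, Nat.add_sub_cancel]

theorem rStar_le (hk₁ : 0 < k₁) (hs : 0 < s) : rStar k₁ (d + 1) s ≤ s := by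
  rw [rStar_eq hk₁ hs]
  exact Nat.mod_lt _ hs

end Sizes

/-! ### The two ideals -/

section ZeroLoci

variable {k₁ d s : ℕ} {w : Fin (outputSize k₁ (d + 1) s) → ℂ}

theorem mem_zeroLocus_idealOne (hk₁ : 0 < k₁) (hs : 0 < s)
    (h : HasCommonFactor (fun i : Fin s => filterComponent k₁ s w i) (fun i => compSize k₁ s i) d) :
    w ∈ MvPolynomial.zeroLocus ℂ (idealOne k₁ (d + 1) s) := by
  rw [idealOne, mem_zeroLocus_minorsIdeal_iff]
  intro f g
  refine h.minor_eq_zero (isShiftMatrix_genericResultantMatrix hk₁ le_rfl _ w) (fun i => ?_) ?_ f g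
  · rw [decompDegree_eq outputSize_succ hk₁ i.2, nStar_eq hk₁ hs]
    have : compSize k₁ s i ≤ cofactorDegree k₁ s + 1 := by
      rcases lt_or_ge (i : ℕ) ((k₁ - 1) % s + 1) with h | h
      · rw [compSize_of_lt hk₁ i.2 h]
      · rw [compSize_of_ge hk₁ i.2 h]; omega
    omega
  · rw [nStar_eq hk₁ hs]; omega

theorem mem_zeroLocus_idealTwo (hk₁ : 0 < k₁) (hs : 0 < s)
    (h : HasCommonFactor (fun i : Fin s => filterComponent k₁ s w i) (fun i => compSize k₁ s i) d) :
    w ∈ MvPolynomial.zeroLocus ℂ (idealTwo k₁ (d + 1) s) := by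
  rw [idealTwo, mem_zeroLocus_minorsIdeal_iff]
  intro f g
  have h' : HasCommonFactor (fun i : Fin (rStar k₁ (d + 1) s) => filterComponent k₁ s w i)
      (fun i => compSize k₁ s i) d := by
    obtain ⟨D, q, hD, hq⟩ := h
    exact ⟨D, fun i => q (i.castLE (rStar_le hk₁ hs)), hD, fun i => hq (i.castLE _)⟩
  refine h'.minor_eq_zero (isShiftMatrix_genericResultantMatrix hk₁ (rStar_le hk₁ hs) _ w)
    (fun i => ?_) ?_ f g
  · have hi := i.2.trans_le (rStar_le hk₁ hs)
    rw [decompDegree_eq outputSize_succ hk₁ hi, nStar_eq hk₁ hs,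
      compSize_of_lt hk₁ hi (rStar_eq (d := d) hk₁ hs ▸ i.2)]
    omega
  · rw [nStar_eq hk₁ hs]; omega

/-- A component of lower degree has `c + 1` rows, one more than those of top degree; this extra row
makes `(c + 1) + c` match the minor size. -/
theorem hasCommonFactor_of_mem_zeroLocus_idealOne (hk₁ : 0 < k₁) (hs : 0 < s)
    (h : w ∈ MvPolynomial.zeroLocus ℂ (idealOne k₁ (d + 1) s)) {j : ℕ} (hjs : j < s)
    (hjr : rStar k₁ (d + 1) s ≤ j) (hj : filterComponent k₁ s w j ≠ 0) :
    HasCommonFactor (fun i : Fin s => filterComponent k₁ s w i) (fun i => compSize k₁ s i) d := by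
  rw [idealOne, mem_zeroLocus_minorsIdeal_iff] at h
  rw [rStar_eq hk₁ hs] at hjr
  have hA : ∀ i : Fin s, compSize k₁ s i ≤ cofactorDegree k₁ s + 1 := by
    intro i
    rcases lt_or_ge (i : ℕ) ((k₁ - 1) % s + 1) with h | h
    · rw [compSize_of_lt hk₁ i.2 h]
    · rw [compSize_of_ge hk₁ i.2 h]; omega
  refine (isShiftMatrix_genericResultantMatrix hk₁ le_rfl _ w).hasCommonFactor
    (fun i => degree_filterComponent_lt rfl w i.2) (E := cofactorDegree k₁ s + 1) (b := cofactorDegree k₁ s)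
    hA (j := ⟨j, hjs⟩) hj ?_ (fun i => ?_) ?_ ?_ ?_ h
  · rw [decompDegree_eq outputSize_succ hk₁ hjs, nStar_eq hk₁ hs, compSize_of_ge hk₁ hjs hjr]
    omega
  · have := hA i
    rw [decompDegree_eq outputSize_succ hk₁ i.2, nStar_eq hk₁ hs]
    omega
  · rw [nStar_eq hk₁ hs, compSize_of_ge hk₁ hjs hjr]
    omega
  · rw [nStar_eq hk₁ hs]
    omega
  · rw [nStar_eq hk₁ hs]
    omega

/-- Only components of top degree remain, each with `c + 1` rows, so the syzygy count is `(c + 1) +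
(c + 1)`; the vanishing components get zero cofactors. -/
theorem hasCommonFactor_of_mem_zeroLocus_idealTwo (hk₁ : 0 < k₁) (hs : 0 < s)
    (h : w ∈ MvPolynomial.zeroLocus ℂ (idealTwo k₁ (d + 1) s))
    (h0 : ∀ j < s, rStar k₁ (d + 1) s ≤ j → filterComponent k₁ s w j = 0) :
    HasCommonFactor (fun i : Fin s => filterComponent k₁ s w i) (fun i => compSize k₁ s i) d := by
  by_cases hall : ∀ i < s, filterComponent k₁ s w i = 0
  · refine ⟨0, 0, by simp [bot_lt_iff_ne_bot], fun i => ⟨by simp [bot_lt_iff_ne_bot], ?_⟩⟩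
    simp [hall i i.2]
  push Not at hall
  obtain ⟨j, hjs, hj⟩ := hall
  have hjr : j < rStar k₁ (d + 1) s := by
    by_contra! hle
    exact hj (h0 j hjs hle)
  have hr := rStar_le (d := d) hk₁ hs
  have hA : ∀ i : Fin (rStar k₁ (d + 1) s), compSize k₁ s i = cofactorDegree k₁ s + 1 := fun i =>
    compSize_of_lt hk₁ (i.2.trans_le hr) (rStar_eq (d := d) hk₁ hs ▸ i.2)
  rw [idealTwo, mem_zeroLocus_minorsIdeal_iff] at h
  have hS : HasCommonFactor (fun i : Fin (rStar k₁ (d + 1) s) => filterComponent k₁ s w i)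
      (fun i => compSize k₁ s i) d := by
    refine (isShiftMatrix_genericResultantMatrix hk₁ hr _ w).hasCommonFactor
      (fun i => degree_filterComponent_lt rfl w (i.2.trans_le hr))
      (E := cofactorDegree k₁ s + 1) (b := cofactorDegree k₁ s + 1) (fun i => (hA i).le)
      (j := ⟨j, hjr⟩) hj ?_ (fun i => ?_) ?_ ?_ ?_ h
    · rw [decompDegree_eq outputSize_succ hk₁ hjs, nStar_eq hk₁ hs, hA ⟨j, hjr⟩]
      omega
    · rw [decompDegree_eq outputSize_succ hk₁ (i.2.trans_le hr), nStar_eq hk₁ hs, hA i]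
      omega
    · rw [hA ⟨j, hjr⟩, nStar_eq hk₁ hs]
      omega
    · rw [nStar_eq hk₁ hs]
      omega
    · rw [nStar_eq hk₁ hs]
      omega
  obtain ⟨D, g, hD, hg⟩ := hS
  refine ⟨D, fun i => if hi : (i : ℕ) < rStar k₁ (d + 1) s then g ⟨i, hi⟩ else 0, hD, fun i => ?_⟩
  by_cases hi : (i : ℕ) < rStar k₁ (d + 1) s
  · simpa only [hi, dif_pos] using hg ⟨i, hi⟩
  · simp [hi, h0 i i.2 (not_lt.mp hi), bot_lt_iff_ne_bot]

/-- A single component contributes only `c + 1` rows, too few for a minor of size `2c + 2`. -/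
theorem idealTwo_eq_bot (hk₁ : 0 < k₁) (hs : 0 < s) (hr : rStar k₁ (d + 1) s = 1) :
    idealTwo k₁ (d + 1) s = ⊥ := by
  rw [idealTwo, minorsIdeal, Ideal.span_eq_bot]
  rintro _ ⟨f, -, rfl⟩
  exfalso
  have hcard := Fintype.card_le_of_embedding f
  rw [Fintype.card_fin, Fintype.card_sigma] at hcard
  have hsum := Finset.sum_le_card_nsmul Finset.univ (fun i : Fin (rStar k₁ (d + 1) s) =>
    Fintype.card (Fin (2 * nStar k₁ (d + 1) s - ((d + 1 : ℕ) : ℤ) + 1 -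
      decompDegree s (outputSize k₁ (d + 1) s - 1) ((i : ℕ) + 1) + 1).toNat))
    (cofactorDegree k₁ s + 1) (fun i _ => by
      have hi := i.2.trans_le (rStar_le hk₁ hs)
      rw [Fintype.card_fin, decompDegree_eq outputSize_succ hk₁ hi, nStar_eq hk₁ hs,
        compSize_of_lt hk₁ hi (rStar_eq (d := d) hk₁ hs ▸ i.2)]
      omega)
  have hone : (Finset.univ : Finset (Fin (rStar k₁ (d + 1) s))).card = 1 := by
    rw [Finset.card_univ, Fintype.card_fin, hr]
  rw [hone, one_smul] at hsum
  have := hcard.trans hsum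
  rw [nStar_eq hk₁ hs] at this
  omega

end ZeroLoci

/-! ### The main theorem -/

theorem corollary3p3 (k₁ k₂ s₁ : ℕ) (hk₁ : 0 < k₁) (hk₂ : 0 < k₂) (hs₁ : 0 < s₁) :
    (filterPoly 1 '' neurovariety k₁ k₂ s₁ =
      filterPoly 1 '' MvPolynomial.zeroLocus ℂ (idealOne k₁ k₂ s₁ + idealTwo k₁ k₂ s₁)) ∧
    (rStar k₁ k₂ s₁ = 1 →
      idealTwo k₁ k₂ s₁ = ⊥ ∧
      idealOne k₁ k₂ s₁ + idealTwo k₁ k₂ s₁ = idealOne k₁ k₂ s₁) ∧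
    (rStar k₁ k₂ s₁ = min k₁ s₁ →
      filterPoly 1 '' neurovariety k₁ k₂ s₁ =
        {Q | Q ∈ filterPoly 1 '' MvPolynomial.zeroLocus ℂ (idealTwo k₁ k₂ s₁) ∧
          ∀ i : ℕ, k₁ < i → i ≤ s₁ →
            decompComponent s₁ (outputSize k₁ k₂ s₁ - 1) i Q = 0}) := by
  obtain ⟨d, rfl⟩ : ∃ d, k₂ = d + 1 := ⟨k₂ - 1, by omega⟩
  refine ⟨?_, fun hr => ?_, fun hr => ?_⟩
  · congr 1
    ext w
    rw [mem_neurovariety_iff_hasCommonFactor hs₁, mem_zeroLocus_add_iff]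
    refine ⟨fun h => ⟨mem_zeroLocus_idealOne hk₁ hs₁ h, mem_zeroLocus_idealTwo hk₁ hs₁ h⟩, ?_⟩
    rintro ⟨h₁, h₂⟩
    by_cases h0 : ∀ j < s₁, rStar k₁ (d + 1) s₁ ≤ j → filterComponent k₁ s₁ w j = 0
    · exact hasCommonFactor_of_mem_zeroLocus_idealTwo hk₁ hs₁ h₂ h0
    · push Not at h0
      obtain ⟨j, hjs, hjr, hj⟩ := h0
      exact hasCommonFactor_of_mem_zeroLocus_idealOne hk₁ hs₁ h₁ hjs hjr hj
  · have h := idealTwo_eq_bot hk₁ hs₁ hr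
    exact ⟨h, by rw [h, Submodule.add_eq_sup, sup_bot_eq]⟩
  · ext Q
    constructor
    · rintro ⟨w, hw, rfl⟩
      rw [mem_neurovariety_iff_hasCommonFactor hs₁] at hw
      refine ⟨⟨w, mem_zeroLocus_idealTwo hk₁ hs₁ hw, rfl⟩, fun i hki his => ?_⟩
      obtain ⟨i, rfl⟩ : ∃ j, i = j + 1 := ⟨i - 1, by omega⟩
      rw [decompComponent_eq_zero_iff outputSize_succ hk₁ his]
      obtain ⟨D, g, -, hg⟩ := hw
      obtain ⟨h1, h2⟩ := hg ⟨i, his⟩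
      -- For `k₁ ≤ i < s₁` the residue class contains no index below `k₁`, so the cofactor must
      -- vanish.
      have hz : compSize k₁ s₁ i = 0 := Nat.div_eq_of_lt (by omega)
      change (g ⟨i, his⟩).degree < (compSize k₁ s₁ i : ℕ) at h1
      rw [hz, degree_lt_iff_coeff_zero] at h1
      have hg0 : g ⟨i, his⟩ = 0 := by
        ext n
        exact h1 n (Nat.zero_le n)
      simpa [hg0] using h2
    · rintro ⟨⟨w, hw, rfl⟩, h0⟩
      refine ⟨w, ?_, rfl⟩
      rw [mem_neurovariety_iff_hasCommonFactor hs₁]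
      refine hasCommonFactor_of_mem_zeroLocus_idealTwo hk₁ hs₁ hw fun j hjs hjr => ?_
      rw [← decompComponent_eq_zero_iff outputSize_succ hk₁ hjs]
      -- From `r = min k₁ s₁ ≤ j < s₁` it follows that `r = k₁`.
      exact h0 (j + 1) (by omega) hjs
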